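/- **Setting.** Let $P$ be a probability distribution on a measurable space $\mathcal Z$, let $\mathcal F$ be a measurable space (the model), and let $(f,z)\mapsto \ell_f(z)\in(-\infty,\infty]$ be a jointly measurable loss. Write $\mathbf E$ for the expectation over $Z\sim P$, with $\mathbf E[U]=\mathbf E[U^+]-\mathbf E[U^-]\in[-\infty,\infty]$. Assume that $\mathbf E[\ell_f^-]<\infty$ for every $f\in\mathcal F$, that $\mathbf E[\ell_f]<\infty$ for some $f\in\mathcal F$, and that $f^*\in\mathcal F$ satisfies $\mathbf E[\ell_{f^*}]=\inf_{f\in\mathcal F}\mathbf E[\ell_f]$. Put $L_f:=\ell_f-\ell_{f^*}$, so that $\mathbf E[L_f]\ge 0$ is the excess risk of $f$. For $\eta>0$ let $$\mathbf E^{\mathrm{ann}(\eta)}[U]:=-\frac1\eta\log\mathbf E\bigl[e^{-\eta U}\bigr].$$ **GRIP.** Let $\Delta(\mathcal F)$ be the set of probability distributions $Q$ on $\mathcal F$ with $\mathbf E_{f\sim Q}[\ell_f(z)^-]<\infty$ for all $z\in\mathcal Z$. For $\eta>0$ and $Q\in\Delta(\mathcal F)$ the mix loss is $m^\eta_Q(z):=-\frac1\eta\log\mathbf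 E_{f\sim Q}[e^{-\eta\ell_f(z)}]$. A GRIP loss (generalized reversed information projection) at $\eta$, written $m^\eta_{\mathcal F}$, is a $P$-integrable function $m:\mathcal Z\to\mathbb R$ that is the limit in $L_1(P)$ of a sequence $m^\eta_{Q_k}$ with $Q_k\in\Delta(\mathcal F)$ and that satisfies $$\mathbf E[m]=\inf_{Q\in\Delta(\mathcal F)}\mathbf E[m^\eta_Q].$$ **Witness condition.** Let $c\in(0,1]$ and $\tau:[0,\infty)\to(0,\infty)$. The $(\tau,c)$-witness condition says that $$\mathbf E\bigl[L_f\cdot\mathbf 1\{L_f\le\tau(\mathbf E[L_f])\}\bigr]\ \ge\ c\,\mathbf E[L_f]\qquad\text{for every } f\in\mathcal F \text{ with } \mathbf E[L_f]>0,$$ and, in particular, that $\mathbf E[L_f]<\infty$ for all $f\in\mathcal F$. For a constant $u>0$, the $(u,c)$-witness condition is the case $\tau\equiv u$. **Lemma.** Let $\bar\eta>0$. If $\inf_{Q\in\Delta(\mathcal F)}\mathbf E[m^{\bar\eta}_Q]>-\infty$, then a GRIP loss at $\bar\eta$ exists. Let $m^{\bar\eta}_{\mathcal F}$ be any GRIP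 loss at $\bar\eta$, let $c\in(0,1]$, and for $\eta\in(0,\bar\eta/2)$ and $a\geq 0$ put $$c'_a:=\frac1c\cdot\frac{\eta a+1}{1-\frac{2\eta}{\bar\eta}}.$$ 1. Let $\tau:[0,\infty)\to[1,\infty)$ be nonincreasing on $(0,\infty)$ and suppose that the $(\tau,c)$-witness condition holds. Then for all $f\in\mathcal F$ and all $\eta\in(0,\bar\eta/2)$, $$\mathbf E[L_f]\ \le\ c'_{2\tau(\mathbf E[L_f])}\cdot\mathbf E^{\mathrm{ann}(\eta)}\bigl[\ell_f-m^{\bar\eta}_{\mathcal F}\bigr].$$ 2. Let $u>0$ and suppose that the $(u,c)$-witness condition holds. Then for all $f\in\mathcal F$ and all $\eta\in(0,\bar\eta/2)$, $$\mathbf E[L_f]\ \le\ c'_{2u}\cdot\mathbf E^{\mathrm{ann}(\eta)}\bigl[\ell_f-m^{\bar\eta}_{\mathcal F}\bigr].$$ No central condition is assumed. -/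

import Mathlib

open MeasureTheory Filter Topology Set

noncomputable section

namespace Grip

variable {F Z : Type*} [MeasurableSpace F] [MeasurableSpace Z]

/-- Expectation of an extended random variable, `E[U⁺] - E[U⁻]`. It is the usual one whenever one
of the two parts is finite. (In the remaining case `∞ - ∞` the value is `⊥` by convention.) -/
def expect (P : Measure Z) (U : Z → EReal) : EReal :=
  ((∫⁻ z, (U z).toENNReal ∂P : ENNReal) : EReal) - ((∫⁻ z, (-U z).toENNReal ∂P : ENNReal) : EReal)

/-- The annealed expectation `-(1/η) log E[exp (-η U)]`. -/
def annealed (P : Measure Z) (η : ℝ) (U : Z → EReal) : EReal :=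
  ((-(1 / η) : ℝ) : EReal) * ENNReal.log (∫⁻ z, EReal.exp (((-η : ℝ) : EReal) * U z) ∂P)

/-- A learning problem `(P, ℓ, F)` with optimal comparator `fstar ∈ F`. The loss takes values
in `(-∞, ∞]`. -/
structure IsLearningProblem (P : Measure Z) (ℓ : F → Z → EReal) (fstar : F) : Prop where
  measurable_loss : Measurable (fun p : F × Z => ℓ p.1 p.2)
  loss_ne_bot : ∀ f z, ℓ f z ≠ ⊥
  negPart_finite : ∀ f, ∫⁻ z, (-ℓ f z).toENNReal ∂P < ⊤
  nontrivial : ∃ f, expect P (ℓ f) < ⊤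
  optimal : ∀ f, expect P (ℓ fstar) ≤ expect P (ℓ f)

/-- The excess loss `L_f = ℓ_f - ℓ_{fstar}`. -/
def excessLoss (ℓ : F → Z → EReal) (fstar f : F) (z : Z) : EReal := ℓ f z - ℓ fstar z

/-- The excess risk `E[L_f]`. -/
def excessRisk (P : Measure Z) (ℓ : F → Z → EReal) (fstar f : F) : EReal :=
  expect P (excessLoss ℓ fstar f)

open Classical in
/-- The `(τ, c)`-witness condition. It is imposed for all `f` of positive excess risk, so that
`τ` matters only on `(0, ∞)`. An infinite excess risk is excluded by the condition, whatever the
threshold: the left side would be `∞` and the right side is at most a real number. -/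
def WitnessCondition (P : Measure Z) (ℓ : F → Z → EReal) (fstar : F) (τ : ℝ → ℝ) (c : ℝ) : Prop :=
  ∀ f, 0 < excessRisk P ℓ fstar f →
    (c : EReal) * excessRisk P ℓ fstar f ≤
      expect P (fun z =>
        if excessLoss ℓ fstar f z ≤ ((τ (excessRisk P ℓ fstar f).toReal : ℝ) : EReal)
        then excessLoss ℓ fstar f z else 0)

/-- The set `Δ(F)` of distributions `Q` on the model, with `E_{f ∼ Q}[ℓ_f(z)⁻]` finite for
every `z`. -/
def modelDistributions (ℓ : F → Z → EReal) : Set (Measure F) :=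
  {Q | IsProbabilityMeasure Q ∧ ∀ z, ∫⁻ f, (-ℓ f z).toENNReal ∂Q < ⊤}

/-- The mix loss `m^η_Q(z) = -(1/η) log E_{f ∼ Q}[exp (-η ℓ_f(z))]`. -/
def mixLoss (η : ℝ) (ℓ : F → Z → EReal) (Q : Measure F) (z : Z) : EReal :=
  ((-(1 / η) : ℝ) : EReal) * ENNReal.log (∫⁻ f, EReal.exp (((-η : ℝ) : EReal) * ℓ f z) ∂Q)

/-- `inf_{Q ∈ Δ(F)} E[m^η_Q]`. If some `E[m^η_Q]` has the form `∞ - ∞`, then mixing `Q` with the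
Dirac measure at `fstar` gives a mix loss of expectation `-∞`; so the convention in `expect`
does not affect this infimum for a learning problem. -/
def mixRisk (P : Measure Z) (η : ℝ) (ℓ : F → Z → EReal) : EReal :=
  ⨅ Q ∈ modelDistributions ℓ, expect P (mixLoss η ℓ Q)

/-- `m` is (a version of) the generalized reversed information projection loss `m^η_F`: it is the
limit in `L¹(P)` of a sequence of mix losses and its expectation is the infimum of `E[m^η_Q]`. -/
structure IsGrip (P : Measure Z) (η : ℝ) (ℓ : F → Z → EReal) (m : Z → ℝ) : Prop where
  integrable : Integrable m P
  integral_eq : ((∫ z, m z ∂P : ℝ) : EReal) = mixRisk P η ℓ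
  isLimit : ∃ Q : ℕ → Measure F, (∀ k, Q k ∈ modelDistributions ℓ) ∧
    Tendsto (fun k => ∫⁻ z, (mixLoss η ℓ (Q k) z - (m z : EReal)).abs ∂P) atTop (𝓝 0)

/-- The constant `c'_a = (1/c) (η a + 1) / (1 - 2 η / ηbar)`. -/
def witnessConst (c η ηbar a : ℝ) : ℝ := 1 / c * ((η * a + 1) / (1 - 2 * η / ηbar))

end Grip

end

noncomputable section

namespace Grip

/-! ### Scalar inequalities -/

lemma exp_bernstein_monotoneOn :
    MonotoneOn (fun s : ℝ => (Real.exp s - s - 1) / s ^ 2) (Ioi 0) := by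
  have hd : ∀ s : ℝ, 0 < s → HasDerivAt (fun s : ℝ => (Real.exp s - s - 1) / s ^ 2)
      (((Real.exp s - 1) * s ^ 2 - (Real.exp s - s - 1) * (2 * s)) / (s ^ 2) ^ 2) s := by
    intro s hs
    have h := (((Real.hasDerivAt_exp s).sub (hasDerivAt_id s)).sub_const 1).div
      (hasDerivAt_pow 2 s) (by positivity)
    refine h.congr_deriv ?_
    simp
  have hk : ∀ s : ℝ, 0 ≤ s → 0 ≤ s + 2 + (s - 2) * Real.exp s := by
    have hder : ∀ s : ℝ, HasDerivAt (fun s : ℝ => s + 2 + (s - 2) * Real.exp s)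
        (1 + (s - 1) * Real.exp s) s := by
      intro s
      have h := ((hasDerivAt_id s).add_const 2).add
        (((hasDerivAt_id s).sub_const 2).mul (Real.hasDerivAt_exp s))
      refine h.congr_deriv ?_
      simp
      ring
    have hmono : MonotoneOn (fun s : ℝ => s + 2 + (s - 2) * Real.exp s) (Ici 0) := by
      refine monotoneOn_of_deriv_nonneg (convex_Ici 0)
        (fun s _ => (hder s).continuousAt.continuousWithinAt)
        (fun s _ => (hder s).differentiableAt.differentiableWithinAt) fun s _ => ?_
      rw [(hder s).deriv]
      have h1 := Real.add_one_le_exp (-s)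
      have h2 : Real.exp (-s) * Real.exp s = 1 := by rw [← Real.exp_add]; simp
      nlinarith [Real.exp_pos s]
    intro s hs
    have := hmono (mem_Ici.2 le_rfl) (mem_Ici.2 hs) hs
    simpa using this
  refine monotoneOn_of_deriv_nonneg (convex_Ioi 0)
    (fun s hs => (hd s hs).continuousAt.continuousWithinAt)
    (fun s hs => (hd s (by simpa using hs)).differentiableAt.differentiableWithinAt)
    fun s hs => ?_
  have hs : 0 < s := by simpa using hs
  rw [(hd s hs).deriv]
  refine div_nonneg ?_ (by positivity)
  nlinarith [mul_nonneg hs.le (hk s hs.le)]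

lemma one_sub_exp_antitoneOn :
    AntitoneOn (fun y : ℝ => (1 - (1 + y) * Real.exp (-y)) / y ^ 2) (Ioi 0) := by
  have hd : ∀ s : ℝ, 0 < s → HasDerivAt (fun y : ℝ => (1 - (1 + y) * Real.exp (-y)) / y ^ 2)
      ((s * Real.exp (-s) * s ^ 2 - (1 - (1 + s) * Real.exp (-s)) * (2 * s)) / (s ^ 2) ^ 2) s := by
    intro s hs
    have he : HasDerivAt (fun y : ℝ => Real.exp (-y)) (-Real.exp (-s)) s := by
      simpa using (hasDerivAt_neg s).exp
    have h := ((((hasDerivAt_id s).const_add 1).mul he).const_sub 1).div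
      (hasDerivAt_pow 2 s) (by positivity)
    refine h.congr_deriv ?_
    simp
    ring
  refine antitoneOn_of_deriv_nonpos (convex_Ioi 0)
    (fun s hs => (hd s hs).continuousAt.continuousWithinAt)
    (fun s hs => (hd s (by simpa using hs)).differentiableAt.differentiableWithinAt)
    fun s hs => ?_
  have hs : 0 < s := by simpa using hs
  rw [(hd s hs).deriv]
  refine div_nonpos_of_nonpos_of_nonneg ?_ (by positivity)
  have h1 := Real.quadratic_le_exp_of_nonneg hs.le
  have h2 : Real.exp (-s) * Real.exp s = 1 := by rw [← Real.exp_add]; simp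
  have h3 : Real.exp (-s) * (1 + s + s ^ 2 / 2) ≤ 1 :=
    (mul_le_mul_of_nonneg_left h1 (Real.exp_pos _).le).trans_eq h2
  nlinarith [mul_nonneg hs.le (sub_nonneg.2 h3)]

/-- `(1 - exp (-ηx)) / η`, a concave surrogate of `x` that tends to `x` as `η → 0`. -/
def expLoss (η x : ℝ) : ℝ := (1 - Real.exp (-(η * x))) / η

lemma expLoss_anti {h H x : ℝ} (hh : 0 < h) (hH : h < H) :
    expLoss H x ≤ expLoss h x := by
  have hH0 : 0 < H := hh.trans hH
  have hc := convexOn_exp.2 (mem_univ (-(H * x))) (mem_univ 0)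
    (show 0 ≤ h / H by positivity)
    (show 0 ≤ 1 - h / H by rw [sub_nonneg, div_le_one hH0]; exact hH.le) (by ring)
  have e1 : h / H * -(H * x) = -(h * x) := by field_simp
  simp only [smul_eq_mul, mul_zero, add_zero, Real.exp_zero, mul_one, e1] at hc
  unfold expLoss
  rw [div_le_div_iff₀ hH0 hh]
  have : h / H * Real.exp (-(H * x)) * H = h * Real.exp (-(H * x)) := by field_simp
  have h3 : (h / H) * H = h := by field_simp
  nlinarith [mul_le_mul_of_nonneg_right hc hH0.le]

lemma expLoss_nonneg {H x : ℝ} (hH : 0 < H) (hx : 0 ≤ x) : 0 ≤ expLoss H x := by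
  refine div_nonneg ?_ hH.le
  rw [sub_nonneg, Real.exp_le_one_iff]
  nlinarith [mul_nonneg hH.le hx]

lemma sub_expLoss_of_nonpos {h H x : ℝ} (hh : 0 < h) (hH : h < H) (hx : x ≤ 0) :
    (1 - h / H) * (x - expLoss H x) ≤ expLoss h x - expLoss H x := by
  have hH0 : 0 < H := hh.trans hH
  rcases hx.eq_or_lt with rfl | hx
  · simp [expLoss]
  have hm := exp_bernstein_monotoneOn (a := -(h * x)) (b := -(H * x))
    (by simp only [mem_Ioi]; nlinarith) (by simp only [mem_Ioi]; nlinarith) (by nlinarith)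
  simp only at hm
  have hx2 : 0 < x ^ 2 := sq_pos_of_neg hx
  rw [div_le_div_iff₀ (by rw [neg_sq, mul_pow]; positivity)
    (by rw [neg_sq, mul_pow]; positivity)] at hm
  have hm' : (Real.exp (-(h * x)) + h * x - 1) * H ^ 2
      ≤ (Real.exp (-(H * x)) + H * x - 1) * h ^ 2 :=
    le_of_mul_le_mul_right (by linarith) hx2
  have key : (Real.exp (-(h * x)) + h * x - 1) / h
      ≤ h / H * ((Real.exp (-(H * x)) + H * x - 1) / H) := by
    rw [div_mul_div_comm, div_le_div_iff₀ hh (by positivity)]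
    linarith
  have e1 : x - expLoss h x = (Real.exp (-(h * x)) + h * x - 1) / h := by
    unfold expLoss; field_simp; ring
  have e2 : x - expLoss H x = (Real.exp (-(H * x)) + H * x - 1) / H := by
    unfold expLoss; field_simp; ring
  rw [← e1, ← e2] at key
  linarith

lemma sub_expLoss_of_pos {h H x : ℝ} (hh : 0 < h) (hH : h < H) (hx : 0 < x) :
    (1 - h / H) * (x - expLoss H x) ≤ (h * x + 1) * (expLoss h x - expLoss H x) := by
  have hH0 : 0 < H := hh.trans hH
  have hm := one_sub_exp_antitoneOn (a := h * x) (b := H * x)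
    (by simp only [mem_Ioi]; positivity) (by simp only [mem_Ioi]; positivity) (by nlinarith)
  simp only at hm
  have hx2 : 0 < x ^ 2 := by positivity
  rw [div_le_div_iff₀ (by positivity) (by positivity)] at hm
  have hm' : (1 - (1 + H * x) * Real.exp (-(H * x))) * h ^ 2
      ≤ (1 - (1 + h * x) * Real.exp (-(h * x))) * H ^ 2 :=
    le_of_mul_le_mul_right (by linarith) hx2
  have key : (h * x + 1) * ((Real.exp (-(h * x)) + h * x - 1) / h)
      ≤ h / H * ((H * x + 1) * ((Real.exp (-(H * x)) + H * x - 1) / H)) := by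
    rw [← mul_div_assoc, ← mul_div_assoc, div_mul_div_comm, div_le_div_iff₀ hh (by positivity)]
    have := mul_le_mul_of_nonneg_right hm' hh.le
    nlinarith
  have e1 : x - expLoss h x = (Real.exp (-(h * x)) + h * x - 1) / h := by
    unfold expLoss; field_simp; ring
  have e2 : x - expLoss H x = (Real.exp (-(H * x)) + H * x - 1) / H := by
    unfold expLoss; field_simp; ring
  rw [← e1, ← e2] at key
  have e3 : h / H * ((H * x + 1) * (x - expLoss H x)) = (h * x + h / H) * (x - expLoss H x) := by
    field_simp
  rw [e3] at key
  linarith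

/-- Below the threshold `u`, the identity is dominated by a combination of `expLoss h` and
`expLoss H` in which the second has the nonpositive weight `-(C - 1)`. -/
lemma le_expLoss_combination {h H u x : ℝ} (hh : 0 < h) (hH : h < H) (hu : 0 < u) (hx : x ≤ u) :
    x ≤ (h * u + 1) / (1 - h / H) * expLoss h x
      - ((h * u + 1) / (1 - h / H) - 1) * expLoss H x := by
  have hH0 : 0 < H := hh.trans hH
  have hr : 0 < 1 - h / H := by rw [sub_pos, div_lt_one hH0]; exact hH
  have hS : 0 ≤ expLoss h x - expLoss H x := sub_nonneg.2 (expLoss_anti hh hH)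
  have key : (1 - h / H) * (x - expLoss H x) ≤ (h * u + 1) * (expLoss h x - expLoss H x) := by
    rcases le_or_gt x 0 with hx0 | hx0
    · refine (sub_expLoss_of_nonpos hh hH hx0).trans (le_mul_of_one_le_left hS ?_)
      nlinarith [mul_pos hh hu]
    · refine (sub_expLoss_of_pos hh hH hx0).trans (mul_le_mul_of_nonneg_right ?_ hS)
      nlinarith
  have : x - expLoss H x ≤ (h * u + 1) / (1 - h / H) * (expLoss h x - expLoss H x) := by
    rw [div_mul_eq_mul_div, le_div_iff₀ hr]
    linarith
  linarith

lemma expLoss_combination_nonneg {h H u x : ℝ} (hh : 0 < h) (hH : h < H) (hu : 0 < u)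
    (hx : 0 ≤ x) :
    0 ≤ (h * u + 1) / (1 - h / H) * expLoss h x
      - ((h * u + 1) / (1 - h / H) - 1) * expLoss H x := by
  have hH0 : 0 < H := hh.trans hH
  have hr : 0 < 1 - h / H := by rw [sub_pos, div_lt_one hH0]; exact hH
  have hC : 0 ≤ (h * u + 1) / (1 - h / H) := by positivity
  have h1 := mul_nonneg hC (sub_nonneg.2 (expLoss_anti (x := x) hh hH))
  have h2 := expLoss_nonneg hH0 hx
  linarith

/-! ### The soft minimum of two losses -/

/-- The mix loss at rate `H` of two losses `x` and `y` with weights `1 - t` and `t`. -/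
def softMin (H t x y : ℝ) : ℝ :=
  -(1 / H) * Real.log ((1 - t) * Real.exp (-(H * x)) + t * Real.exp (-(H * y)))

section SoftMin

variable {H t x y : ℝ}

lemma softMin_arg_pos (ht : t ∈ Icc (0 : ℝ) 1) :
    0 < (1 - t) * Real.exp (-(H * x)) + t * Real.exp (-(H * y)) := by
  rcases ht.1.eq_or_lt with h0 | h0
  · rw [← h0]; simpa using Real.exp_pos _
  · have := sub_nonneg.2 ht.2
    positivity

lemma exp_softMin (hH : 0 < H) (ht : t ∈ Icc (0 : ℝ) 1) :
    Real.exp (-(H * softMin H t x y))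
      = (1 - t) * Real.exp (-(H * x)) + t * Real.exp (-(H * y)) := by
  have : -(H * softMin H t x y)
      = Real.log ((1 - t) * Real.exp (-(H * x)) + t * Real.exp (-(H * y))) := by
    unfold softMin; field_simp
  rw [this, Real.exp_log (softMin_arg_pos ht)]

lemma le_softMin {a : ℝ} (hH : 0 < H) (ht : t ∈ Icc (0 : ℝ) 1) (hx : a ≤ x) (hy : a ≤ y) :
    a ≤ softMin H t x y := by
  have h1 : Real.exp (-(H * softMin H t x y)) ≤ Real.exp (-(H * a)) := by
    rw [exp_softMin hH ht]
    have hx' : Real.exp (-(H * x)) ≤ Real.exp (-(H * a)) := Real.exp_le_exp.2 (by nlinarith)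
    have hy' : Real.exp (-(H * y)) ≤ Real.exp (-(H * a)) := Real.exp_le_exp.2 (by nlinarith)
    nlinarith [mul_le_mul_of_nonneg_left hx' (sub_nonneg.2 ht.2),
      mul_le_mul_of_nonneg_left hy' ht.1]
  have h2 := Real.exp_le_exp.1 h1
  exact le_of_mul_le_mul_left (by linarith) hH

lemma softMin_le {a : ℝ} (hH : 0 < H) (ht : t ∈ Icc (0 : ℝ) 1) (hx : x ≤ a) (hy : y ≤ a) :
    softMin H t x y ≤ a := by
  have h1 : Real.exp (-(H * a)) ≤ Real.exp (-(H * softMin H t x y)) := by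
    rw [exp_softMin hH ht]
    have hx' : Real.exp (-(H * a)) ≤ Real.exp (-(H * x)) := Real.exp_le_exp.2 (by nlinarith)
    have hy' : Real.exp (-(H * a)) ≤ Real.exp (-(H * y)) := Real.exp_le_exp.2 (by nlinarith)
    nlinarith [mul_le_mul_of_nonneg_left hx' (sub_nonneg.2 ht.2),
      mul_le_mul_of_nonneg_left hy' ht.1]
  have h2 := Real.exp_le_exp.1 h1
  exact le_of_mul_le_mul_left (by linarith) hH

lemma abs_softMin_le (hH : 0 < H) (ht : t ∈ Icc (0 : ℝ) 1) :
    |softMin H t x y| ≤ |x| + |y| := by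
  rw [abs_le]
  constructor
  · exact le_softMin hH ht (by linarith [neg_abs_le x, abs_nonneg y])
      (by linarith [neg_abs_le y, abs_nonneg x])
  · exact softMin_le hH ht (by linarith [le_abs_self x, abs_nonneg y])
      (by linarith [le_abs_self y, abs_nonneg x])

lemma softMin_zero (hH : 0 < H) : softMin H 0 x y = x := by
  unfold softMin; simp; field_simp

lemma softMin_one (hH : 0 < H) : softMin H 1 x y = y := by
  unfold softMin; simp; field_simp

lemma continuousOn_softMin : ContinuousOn (fun t => softMin H t x y) (Icc 0 1) := by
  unfold softMin
  refine continuousOn_const.mul (ContinuousOn.log (by fun_prop) fun t ht => ?_)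
  exact (softMin_arg_pos ht).ne'

lemma measurable_softMin : Measurable fun p : ℝ × ℝ => softMin H t p.1 p.2 := by
  unfold softMin; fun_prop

/-- Mixing `softMin H s x y` further with `y` amounts to increasing the weight of `y`. -/
lemma softMin_softMin {s : ℝ} (hH : 0 < H) (hs : s ∈ Icc (0 : ℝ) 1) :
    softMin H t (softMin H s x y) y = softMin H (s + t * (1 - s)) x y := by
  rw [softMin, exp_softMin hH hs, softMin]
  congr 2
  ring

lemma softMin_sub (hH : 0 < H) (ht : t ∈ Icc (0 : ℝ) 1) :
    Real.log (1 - t + t * Real.exp (-(H * (y - x)))) = H * (x - softMin H t x y) := by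
  rw [← Real.log_exp (H * (x - softMin H t x y))]
  congr 1
  have : H * (x - softMin H t x y) = H * x + -(H * softMin H t x y) := by ring
  rw [this, Real.exp_add, exp_softMin hH ht, mul_add, mul_left_comm, mul_left_comm _ t,
    ← Real.exp_add, ← Real.exp_add]
  simp only [add_neg_cancel, Real.exp_zero, mul_one]
  congr 3
  ring

/-- The gap between the average of two losses and their even mix loss controls their distance. -/
lemma abs_sub_le_softMin_gap {ε : ℝ} (hH : 0 < H) (hε : 0 < ε) :
    |x - y| ≤ 2 / H * ε
      + 2 / Real.tanh ε * ((x + y) / 2 - softMin H (1 / 2) x y) := by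
  set d := H * (x - y) / 2 with hd
  have hthpos : 0 < Real.tanh ε := by
    rw [Real.tanh_eq_sinh_div_cosh]
    exact div_pos (Real.sinh_pos_iff.2 hε) (Real.cosh_pos ε)
  have hth1 : Real.tanh ε < 1 := Real.tanh_lt_one ε
  have hcosh : Real.exp (H * ((x + y) / 2 - softMin H (1 / 2) x y)) = Real.cosh d := by
    have e : H * ((x + y) / 2 - softMin H (1 / 2) x y)
        = H * (x + y) / 2 + -(H * softMin H (1 / 2) x y) := by ring
    rw [e, Real.exp_add, exp_softMin hH (by norm_num), Real.cosh_eq, mul_add, mul_left_comm,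
      mul_left_comm _ (1 / 2 : ℝ), ← Real.exp_add, ← Real.exp_add]
    have e1 : H * (x + y) / 2 + -(H * x) = -d := by rw [hd]; ring
    have e2 : H * (x + y) / 2 + -(H * y) = d := by rw [hd]; ring
    rw [e1, e2]; ring
  have hlow : Real.exp (Real.tanh ε * (|d| - ε)) ≤ Real.cosh d := by
    rw [← Real.cosh_abs]
    rcases le_or_gt |d| ε with hle | hgt
    · refine le_trans (Real.exp_le_one_iff.2 ?_) (Real.one_le_cosh _)
      nlinarith
    · set r := |d| - ε with hr
      have hdr : |d| = ε + r := by rw [hr]; ring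
      have hconv := convexOn_exp.2 (mem_univ r) (mem_univ (-r))
        (show 0 ≤ (1 + Real.tanh ε) / 2 by linarith)
        (show 0 ≤ (1 - Real.tanh ε) / 2 by linarith) (by ring)
      simp only [smul_eq_mul] at hconv
      have e : (1 + Real.tanh ε) / 2 * r + (1 - Real.tanh ε) / 2 * -r = Real.tanh ε * r := by ring
      rw [e] at hconv
      refine hconv.trans ?_
      have e4 : (1 + Real.tanh ε) / 2 * Real.exp r + (1 - Real.tanh ε) / 2 * Real.exp (-r)
          = Real.cosh r + Real.tanh ε * Real.sinh r := by
        rw [Real.cosh_eq, Real.sinh_eq]; ring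
      rw [e4, hdr, Real.cosh_add]
      have e5 : Real.sinh ε = Real.cosh ε * Real.tanh ε := by
        rw [Real.tanh_eq_sinh_div_cosh]; field_simp [(Real.cosh_pos ε).ne']
      rw [e5]
      have h0 : 0 ≤ Real.cosh r + Real.tanh ε * Real.sinh r := by
        rw [← e4]
        have := Real.exp_pos r
        have := Real.exp_pos (-r)
        have : 0 ≤ 1 - Real.tanh ε := by linarith
        positivity
      nlinarith [Real.one_le_cosh ε]
  rw [← hcosh, Real.exp_le_exp] at hlow
  have habs : |d| = H / 2 * |x - y| := by
    rw [hd, mul_div_right_comm, abs_mul, abs_of_pos (by positivity)]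
  rw [habs] at hlow
  have : H / 2 * |x - y| ≤ ε + H / Real.tanh ε * ((x + y) / 2 - softMin H (1 / 2) x y) := by
    have h3 : H / Real.tanh ε * ((x + y) / 2 - softMin H (1 / 2) x y)
        = H * ((x + y) / 2 - softMin H (1 / 2) x y) / Real.tanh ε := by ring
    rw [← sub_le_iff_le_add', h3, le_div_iff₀ hthpos]
    linarith
  have h2 := mul_le_mul_of_nonneg_left this (show 0 ≤ 2 / H by positivity)
  have e1 : 2 / H * (H / 2 * |x - y|) = |x - y| := by field_simp
  have e2 : 2 / H * (ε + H / Real.tanh ε * ((x + y) / 2 - softMin H (1 / 2) x y))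
      = 2 / H * ε + 2 / Real.tanh ε * ((x + y) / 2 - softMin H (1 / 2) x y) := by
    field_simp
  linarith

end SoftMin

/-! ### Mixing integrable losses -/

section Integral

variable {Z : Type*} [MeasurableSpace Z] {P : Measure Z} {H : ℝ}

lemma integrable_softMin {t : ℝ} {X Y : Z → ℝ} (hH : 0 < H) (ht : t ∈ Icc (0 : ℝ) 1)
    (hX : Integrable X P) (hY : Integrable Y P) :
    Integrable (fun z => softMin H t (X z) (Y z)) P := by
  refine (hX.abs.add hY.abs).mono'
    (measurable_softMin.comp_aemeasurable
      (hX.aemeasurable.prodMk hY.aemeasurable)).aestronglyMeasurable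
    (Eventually.of_forall fun z => ?_)
  rw [Real.norm_eq_abs]
  exact abs_softMin_le hH ht

lemma lintegral_le_of_tendsto {f : ℕ → Z → ENNReal} {g : Z → ENNReal} {c : ℕ → ENNReal}
    {C : ENNReal} (hf : ∀ n, AEMeasurable (f n) P)
    (hlim : ∀ᵐ z ∂P, Tendsto (fun n => f n z) atTop (𝓝 (g z)))
    (hc : ∀ n, ∫⁻ z, f n z ∂P ≤ c n) (hC : Tendsto c atTop (𝓝 C)) :
    ∫⁻ z, g z ∂P ≤ C := by
  calc ∫⁻ z, g z ∂P = ∫⁻ z, liminf (fun n => f n z) atTop ∂P :=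
        lintegral_congr_ae (hlim.mono fun z hz => hz.liminf_eq.symm)
    _ ≤ liminf (fun n => ∫⁻ z, f n z ∂P) atTop := lintegral_liminf_le' hf
    _ ≤ liminf c atTop := liminf_le_liminf (Eventually.of_forall hc)
    _ = C := hC.liminf_eq

lemma log_mix_div_add_two_nonneg {t W : ℝ} (ht0 : 0 < t) (ht : t ≤ 1 / 2) (hW : 0 < W) :
    0 ≤ Real.log (1 - t + t * W) / t + 2 := by
  have h1 : 1 - (1 - t)⁻¹ ≤ Real.log (1 - t) := Real.one_sub_inv_le_log_of_pos (by linarith)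
  have h2 : Real.log (1 - t) ≤ Real.log (1 - t + t * W) :=
    Real.log_le_log (by linarith) (by nlinarith)
  have h3 : (1 - t)⁻¹ ≤ 1 + 2 * t := by
    rw [inv_le_iff_one_le_mul₀ (by linarith)]; nlinarith
  have h4 : -2 * t ≤ Real.log (1 - t + t * W) := by linarith
  have h5 : -2 ≤ Real.log (1 - t + t * W) / t := by rwa [le_div_iff₀ ht0]
  linarith

/-- If mixing `N` into an asymptotically risk minimizing sequence `M k → m` never brings the risk
below `∫ m`, then `E[exp (-H (N - m))] ≤ 1`. -/
lemma lintegral_exp_le_one_of_forall_softMin [IsProbabilityMeasure P]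
    {M : ℕ → Z → ℝ} {m N : Z → ℝ} (hH : 0 < H)
    (hM : ∀ k, Integrable (M k) P) (hm : Integrable m P)
    (hlim : Tendsto (fun k => ∫⁻ z, ‖M k z - m z‖ₑ ∂P) atTop (𝓝 0)) (hN : Integrable N P)
    (hmin : ∀ k, ∀ t ∈ Icc (0 : ℝ) 1, ∫ z, m z ∂P ≤ ∫ z, softMin H t (M k z) (N z) ∂P) :
    ∫⁻ z, ENNReal.ofReal (Real.exp (-(H * (N z - m z)))) ∂P ≤ 1 := by
  have hmeas : TendstoInMeasure P M atTop m := by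
    refine tendstoInMeasure_of_tendsto_eLpNorm (p := 1) one_ne_zero
      (fun k => (hM k).aestronglyMeasurable) hm.aestronglyMeasurable ?_
    simpa only [eLpNorm_one_eq_lintegral_enorm, Pi.sub_apply] using hlim
  obtain ⟨φ, hφ, hae⟩ := hmeas.exists_seq_tendsto_ae
  have hint : Tendsto (fun k => ∫ z, M k z ∂P) atTop (𝓝 (∫ z, m z ∂P)) :=
    tendsto_integral_of_L1 m hm.aestronglyMeasurable (Eventually.of_forall hM) hlim
  have hlog : ∀ t : ℝ, 0 < t → t ≤ 1 / 2 →
      ∫⁻ z, ENNReal.ofReal (Real.log (1 - t + t * Real.exp (-(H * (N z - m z)))) / t + 2) ∂P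
        ≤ 2 := by
    intro t ht0 ht
    have htI : t ∈ Icc (0 : ℝ) 1 := ⟨ht0.le, by linarith⟩
    have hI : ∀ k, Integrable (fun z =>
        Real.log (1 - t + t * Real.exp (-(H * (N z - M k z)))) / t + 2) P := by
      intro k
      simp_rw [softMin_sub hH htI]
      exact ((((hM k).sub (integrable_softMin hH htI (hM k) hN)).const_mul H).div_const t).add
        (integrable_const 2)
    have hC : Tendsto (fun j => ENNReal.ofReal
        (H * (∫ z, M (φ j) z ∂P - ∫ z, m z ∂P) / t + 2)) atTop (𝓝 2) := by
      have h2 : (2 : ENNReal) = ENNReal.ofReal (H * (∫ z, m z ∂P - ∫ z, m z ∂P) / t + 2) := by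
        simp
      rw [h2]
      exact ENNReal.tendsto_ofReal (((((hint.comp hφ.tendsto_atTop).sub_const _).const_mul
        H).div_const t).add_const 2)
    refine lintegral_le_of_tendsto (f := fun j z => ENNReal.ofReal
        (Real.log (1 - t + t * Real.exp (-(H * (N z - M (φ j) z)))) / t + 2))
      (fun j => (hI (φ j)).aemeasurable.ennreal_ofReal) ?_ (fun j => ?_) hC
    · filter_upwards [hae] with z hz
      refine ENNReal.tendsto_ofReal (((Tendsto.log ?_ ?_).div_const t).add_const 2)
      · have : Continuous fun r : ℝ => 1 - t + t * Real.exp (-(H * (N z - r))) := by fun_prop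
        exact (this.tendsto (m z)).comp hz
      · have := Real.exp_pos (-(H * (N z - m z)))
        have : 0 < 1 - t := by linarith
        positivity
    · rw [← ofReal_integral_eq_lintegral_ofReal (hI _) (Eventually.of_forall fun z =>
        log_mix_div_add_two_nonneg ht0 ht (Real.exp_pos _))]
      refine ENNReal.ofReal_le_ofReal ?_
      have hS := integrable_softMin hH htI (hM (φ j)) hN
      have hD : Integrable (fun z => H * (M (φ j) z - softMin H t (M (φ j) z) (N z)) / t) P :=
        (((hM (φ j)).sub hS).const_mul H).div_const t
      have hE : ∫ z, (Real.log (1 - t + t * Real.exp (-(H * (N z - M (φ j) z)))) / t + 2) ∂P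
          = H * (∫ z, M (φ j) z ∂P - ∫ z, softMin H t (M (φ j) z) (N z) ∂P) / t + 2 := by
        simp_rw [softMin_sub hH htI]
        rw [integral_add hD (integrable_const 2),
          integral_div, integral_const_mul, integral_sub (hM (φ j)) hS]
        simp
      rw [hE]
      have := hmin (φ j) t htI
      gcongr
  have hfin : ∫⁻ z, ENNReal.ofReal (Real.exp (-(H * (N z - m z))) + 1) ∂P ≤ 2 := by
    have hmN : AEMeasurable (fun z => N z - m z) P := hN.aemeasurable.sub hm.aemeasurable
    refine lintegral_le_of_tendsto (f := fun n z => ENNReal.ofReal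
      (Real.log (1 - ((n : ℝ) + 2)⁻¹ + ((n : ℝ) + 2)⁻¹ * Real.exp (-(H * (N z - m z))))
        / ((n : ℝ) + 2)⁻¹ + 2)) (c := fun _ => 2) (fun n => ?_)
      (Eventually.of_forall fun z => ?_) (fun n => hlog _ (by positivity) ?_) tendsto_const_nhds
    · exact ((((hmN.const_mul H).neg.exp.const_mul _).const_add _).log.div_const _).add_const _
        |>.ennreal_ofReal
    · refine ENNReal.tendsto_ofReal ?_
      have h1 : Tendsto (fun n : ℕ => (n : ℝ) + 2) atTop atTop :=
        tendsto_atTop_add_const_right _ _ tendsto_natCast_atTop_atTop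
      have h2 := ((Real.tendsto_mul_log_one_add_div_atTop
        (Real.exp (-(H * (N z - m z))) - 1)).comp h1).add_const 2
      refine (h2.congr fun n => ?_).trans_eq ?_
      · have : (0 : ℝ) < n + 2 := by positivity
        simp only [Function.comp]
        rw [div_inv_eq_mul, mul_comm]
        congr 3
        ring
      · congr 1; ring
    · rw [one_div]; gcongr; linarith [(Nat.cast_nonneg n : (0 : ℝ) ≤ n)]
  have hadd : ∀ z, ENNReal.ofReal (Real.exp (-(H * (N z - m z))) + 1)
      = ENNReal.ofReal (Real.exp (-(H * (N z - m z)))) + 1 := fun z => by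
    rw [ENNReal.ofReal_add (Real.exp_pos _).le zero_le_one, ENNReal.ofReal_one]
  simp_rw [hadd] at hfin
  rw [lintegral_add_right _ measurable_const] at hfin
  simp only [lintegral_const, measure_univ, mul_one] at hfin
  rw [← one_add_one_eq_two] at hfin
  exact (ENNReal.add_le_add_iff_right ENNReal.one_ne_top).1 hfin

lemma exists_forall_integral_softMin_le {X Y : Z → ℝ} (hH : 0 < H)
    (hX : Integrable X P) (hY : Integrable Y P) :
    ∃ α ∈ Icc (0 : ℝ) 1, ∀ s ∈ Icc (0 : ℝ) 1,
      ∫ z, softMin H α (X z) (Y z) ∂P ≤ ∫ z, softMin H s (X z) (Y z) ∂P := by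
  have hcont : ContinuousOn (fun s => ∫ z, softMin H s (X z) (Y z) ∂P) (Icc 0 1) :=
    continuousOn_of_dominated
      (fun s hs => (integrable_softMin hH hs hX hY).aestronglyMeasurable)
      (fun s hs => Eventually.of_forall fun z => by
        rw [Real.norm_eq_abs]; exact abs_softMin_le hH hs)
      (hX.abs.add hY.abs) (Eventually.of_forall fun z => continuousOn_softMin)
  obtain ⟨α, hα, hmin⟩ := isCompact_Icc.exists_isMinOn ⟨0, by simp⟩ hcont
  exact ⟨α, hα, fun s hs => hmin hs⟩

lemma expLoss_add_le (η x y : ℝ) (hη : 0 < η) :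
    expLoss (2 * η) x + expLoss (2 * η) y ≤ expLoss η (x + y) := by
  have h1 : Real.exp (-(η * (x + y))) = Real.exp (-(η * x)) * Real.exp (-(η * y)) := by
    rw [← Real.exp_add]; ring_nf
  have h2 : ∀ x, Real.exp (-(2 * η * x)) = Real.exp (-(η * x)) ^ 2 := fun x => by
    rw [← Real.exp_nat_mul]; congr 1; push_cast; ring
  unfold expLoss
  rw [h1, h2, h2, ← add_div, div_le_div_iff₀ (by positivity) hη]
  nlinarith [mul_nonneg hη.le (sq_nonneg (Real.exp (-(η * x)) - Real.exp (-(η * y))))]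

lemma integrable_exp_of_lintegral_le_one {X : Z → ℝ} (hX : AEMeasurable X P)
    (h : ∫⁻ z, ENNReal.ofReal (Real.exp (-(H * X z))) ∂P ≤ 1) :
    Integrable (fun z => Real.exp (-(H * X z))) P ∧ ∫ z, Real.exp (-(H * X z)) ∂P ≤ 1 := by
  have hm : AEStronglyMeasurable (fun z => Real.exp (-(H * X z))) P :=
    (hX.const_mul H).neg.exp.aestronglyMeasurable
  have hnn : 0 ≤ᵐ[P] fun z => Real.exp (-(H * X z)) :=
    Eventually.of_forall fun z => (Real.exp_pos _).le
  refine ⟨⟨hm, ?_⟩, ?_⟩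
  · rw [hasFiniteIntegral_iff_ofReal hnn]
    exact h.trans_lt ENNReal.one_lt_top
  · rw [integral_eq_lintegral_of_nonneg_ae hnn hm]
    exact ENNReal.toReal_le_of_le_ofReal zero_le_one (by simpa using h)

lemma integrable_exp_of_le [IsProbabilityMeasure P] {h : ℝ} {X : Z → ℝ} (hX : AEMeasurable X P)
    (hh : 0 < h) (hhH : h ≤ H)
    (hI : Integrable (fun z => Real.exp (-(H * X z))) P) :
    Integrable (fun z => Real.exp (-(h * X z))) P := by
  refine (hI.add (integrable_const 1)).mono' (hX.const_mul h).neg.exp.aestronglyMeasurable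
    (Eventually.of_forall fun z => ?_)
  rw [Real.norm_eq_abs, Real.abs_exp]
  simp only [Pi.add_apply]
  rcases le_total 0 (X z) with hz | hz
  · have : Real.exp (-(h * X z)) ≤ 1 := Real.exp_le_one_iff.2 (by nlinarith)
    linarith [Real.exp_pos (-(H * X z))]
  · have : Real.exp (-(h * X z)) ≤ Real.exp (-(H * X z)) := Real.exp_le_exp.2 (by nlinarith)
    linarith

lemma integrable_expLoss [IsProbabilityMeasure P] {h : ℝ} {X : Z → ℝ}
    (hI : Integrable (fun z => Real.exp (-(h * X z))) P) :
    Integrable (fun z => expLoss h (X z)) P :=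
  ((integrable_const 1).sub hI).div_const h

lemma integral_expLoss [IsProbabilityMeasure P] {h : ℝ} {X : Z → ℝ}
    (hI : Integrable (fun z => Real.exp (-(h * X z))) P) :
    ∫ z, expLoss h (X z) ∂P = (1 - ∫ z, Real.exp (-(h * X z)) ∂P) / h := by
  unfold expLoss
  rw [integral_div, integral_sub (integrable_const 1) hI]
  simp

lemma integral_exp_le_one_of_le [IsProbabilityMeasure P] {h : ℝ} {X : Z → ℝ} (hh : 0 < h)
    (hhH : h < H) (hh1 : Integrable (fun z => Real.exp (-(h * X z))) P)
    (hI : Integrable (fun z => Real.exp (-(H * X z))) P)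
    (hle : ∫ z, Real.exp (-(H * X z)) ∂P ≤ 1) :
    ∫ z, Real.exp (-(h * X z)) ∂P ≤ 1 := by
  have h0 : 0 ≤ ∫ z, expLoss H (X z) ∂P := by
    rw [integral_expLoss hI]
    exact div_nonneg (by linarith) (hh.trans hhH).le
  have h1 := h0.trans (integral_mono (integrable_expLoss hI) (integrable_expLoss hh1)
      fun z => expLoss_anti hh hhH)
  rw [integral_expLoss hh1, le_div_iff₀ hh] at h1
  linarith

/-- The truncated excess risk of `a` over `b` is bounded through the exponential moment of `a - m`,
when `m` dominates all mixtures of `a` and `b` in the sense of the GRIP inequality. -/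
lemma integral_truncated_le [IsProbabilityMeasure P] {a b m : Z → ℝ} {η u : ℝ}
    (hη : 0 < η) (hηH : 2 * η < H) (hu : 0 < u)
    (ha : Integrable a P) (hb : Integrable b P) (hm : Integrable m P)
    (hma : Measurable a) (hmb : Measurable b)
    (hG : ∀ s ∈ Icc (0 : ℝ) 1,
      ∫⁻ z, ENNReal.ofReal (Real.exp (-(H * (softMin H s (b z) (a z) - m z)))) ∂P ≤ 1) :
    ∫ z, (if a z - b z ≤ u then a z - b z else 0) ∂P
      ≤ (2 * η * u + 1) / (1 - 2 * η / H)
        * ((1 - ∫ z, Real.exp (-(η * (a z - m z))) ∂P) / η) := by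
  have hH : 0 < H := by linarith
  obtain ⟨α, hα, hmin⟩ := exists_forall_integral_softMin_le (P := P) hH hb ha
  set g : Z → ℝ := fun z => softMin H α (b z) (a z) with hg
  have hgI : Integrable g P := integrable_softMin hH hα hb ha
  have hU : ∫⁻ z, ENNReal.ofReal (Real.exp (-(H * (a z - g z)))) ∂P ≤ 1 := by
    refine lintegral_exp_le_one_of_forall_softMin (M := fun _ => g) hH (fun _ => hgI) hgI
      (by simp) ha fun _ t ht => ?_
    have h1 := sub_nonneg.2 hα.2
    have h2 := sub_nonneg.2 ht.2
    have : ∀ z, softMin H t (g z) (a z) = softMin H (α + t * (1 - α)) (b z) (a z) :=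
      fun z => softMin_softMin hH hα
    simp_rw [this]
    exact hmin _ ⟨by nlinarith [hα.1, ht.1], by nlinarith [hα.1, ht.1]⟩
  have hUm : AEMeasurable (fun z => a z - g z) P := ha.aemeasurable.sub hgI.aemeasurable
  have hVm : AEMeasurable (fun z => g z - m z) P := hgI.aemeasurable.sub hm.aemeasurable
  have hbgI : Integrable (fun z => b z - g z) P := hb.sub hgI
  obtain ⟨hUI, hU1⟩ := integrable_exp_of_lintegral_le_one hUm hU
  obtain ⟨hVI, hV1⟩ := integrable_exp_of_lintegral_le_one hVm (hG α hα)
  have hUh := integrable_exp_of_le hUm (by positivity : 0 < 2 * η) hηH.le hUI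
  have hVh := integrable_exp_of_le hVm (by positivity : 0 < 2 * η) hηH.le hVI
  have hXI : Integrable (fun z => Real.exp (-(η * (a z - m z)))) P := by
    have h1 := hG 1 (by simp)
    simp_rw [softMin_one hH] at h1
    have hXm : AEMeasurable (fun z => a z - m z) P := ha.aemeasurable.sub hm.aemeasurable
    exact integrable_exp_of_le hXm hη (by linarith) (integrable_exp_of_lintegral_le_one hXm h1).1
  set C := (2 * η * u + 1) / (1 - 2 * η / H) with hCdef
  have hr : 0 < 1 - 2 * η / H := by rw [sub_pos, div_lt_one hH]; exact hηH
  have hC1 : 1 ≤ C := by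
    rw [hCdef, le_div_iff₀ hr]
    have : 0 < 2 * η / H := by positivity
    nlinarith [mul_pos hη hu]
  have hSU : 0 ≤ ∫ z, expLoss H (a z - g z) ∂P := by
    rw [integral_expLoss hUI]
    exact div_nonneg (by linarith) hH.le
  have hSV : 0 ≤ ∫ z, expLoss (2 * η) (g z - m z) ∂P := by
    rw [integral_expLoss hVh]
    have := integral_exp_le_one_of_le (by positivity) hηH hVh hVI hV1
    exact div_nonneg (by linarith) (by positivity)
  have hbg : 0 ≤ ∫ z, (b z - g z) ∂P := by
    rw [integral_sub hb hgI, sub_nonneg]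
    have := hmin 0 (by simp)
    simpa only [softMin_zero hH] using this
  have hIU := integrable_expLoss hUI
  have hIUh := integrable_expLoss hUh
  have hIVh := integrable_expLoss hVh
  have hIX := integrable_expLoss hXI
  have hTI : Integrable (fun z => if a z - b z ≤ u then a z - b z else 0) P := by
    refine (ha.sub hb).norm.mono' (Measurable.ite
      (measurableSet_le (hma.sub hmb) measurable_const) (hma.sub hmb)
      measurable_const).aestronglyMeasurable (Eventually.of_forall fun z => ?_)
    split_ifs
    · rfl
    · simp
  have hDI : Integrable (fun z =>
      C * expLoss (2 * η) (a z - g z) - (C - 1) * expLoss H (a z - g z)) P :=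
    (hIUh.const_mul C).sub (hIU.const_mul (C - 1))
  calc ∫ z, (if a z - b z ≤ u then a z - b z else 0) ∂P
      ≤ ∫ z, ((C * expLoss (2 * η) (a z - g z) - (C - 1) * expLoss H (a z - g z))
          - (b z - g z)) ∂P := by
        refine integral_mono hTI (hDI.sub hbgI) fun z => ?_
        show (if a z - b z ≤ u then a z - b z else 0) ≤ _
        split_ifs with hz
        · have hgz : a z - g z ≤ u := by
            have : a z - u ≤ g z := le_softMin hH hα (by linarith) (by linarith)
            linarith
          have := le_expLoss_combination (by positivity : 0 < 2 * η) hηH hu hgz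
          rw [← hCdef] at this
          linarith
        · have hgb : b z ≤ g z := le_softMin hH hα le_rfl (by linarith)
          have hga : g z ≤ a z := softMin_le hH hα (by linarith) le_rfl
          have := expLoss_combination_nonneg (by positivity : 0 < 2 * η) hηH hu (sub_nonneg.2 hga)
          rw [← hCdef] at this
          linarith
    _ = C * ∫ z, expLoss (2 * η) (a z - g z) ∂P - (C - 1) * ∫ z, expLoss H (a z - g z) ∂P
          - ∫ z, (b z - g z) ∂P := by
        rw [integral_sub hDI hbgI, integral_sub (hIUh.const_mul C) (hIU.const_mul (C - 1)),
          integral_const_mul,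
          integral_const_mul]
    _ ≤ C * (∫ z, expLoss (2 * η) (a z - g z) ∂P + ∫ z, expLoss (2 * η) (g z - m z) ∂P) := by
        nlinarith [mul_nonneg (sub_nonneg.2 hC1) hSU]
    _ ≤ C * ∫ z, expLoss η (a z - m z) ∂P := by
        refine mul_le_mul_of_nonneg_left ?_ (by linarith)
        rw [← integral_add hIUh hIVh]
        refine integral_mono (hIUh.add hIVh) hIX fun z => ?_
        have h := expLoss_add_le η (a z - g z) (g z - m z) hη
        rwa [sub_add_sub_cancel] at h
    _ = C * ((1 - ∫ z, Real.exp (-(η * (a z - m z))) ∂P) / η) := by rw [integral_expLoss hXI]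

/-- An asymptotically risk minimizing sequence, in a class closed under even mixing, converges
in `L¹`. -/
lemma exists_tendsto_of_integral_softMin_ge [IsProbabilityMeasure P] {M : ℕ → Z → ℝ} {v : ℝ} (hH : 0 < H)
    (hM : ∀ k, Integrable (M k) P) (hlim : Tendsto (fun k => ∫ z, M k z ∂P) atTop (𝓝 v))
    (hmin : ∀ j k, v ≤ ∫ z, softMin H (1 / 2) (M j z) (M k z) ∂P) :
    ∃ m : Z → ℝ, Integrable m P ∧ ∫ z, m z ∂P = v ∧
      Tendsto (fun k => ∫⁻ z, ‖M k z - m z‖ₑ ∂P) atTop (𝓝 0) := by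
  have hhalf : (1 / 2 : ℝ) ∈ Icc (0 : ℝ) 1 := by norm_num
  have hdist : ∀ j k, dist ((hM j).toL1 (M j)) ((hM k).toL1 (M k)) = ∫ z, |M j z - M k z| ∂P := by
    intro j k
    rw [dist_eq_norm, ← Integrable.toL1_sub, L1.norm_of_fun_eq_integral_norm]
    rfl
  have hcauchy : CauchySeq fun k => (hM k).toL1 (M k) := by
    rw [Metric.cauchySeq_iff']
    intro ε hε
    set δ := H * ε / 4 with hδ
    have hδ0 : 0 < δ := by positivity
    have hth : 0 < Real.tanh δ := by
      rw [Real.tanh_eq_sinh_div_cosh]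
      exact div_pos (Real.sinh_pos_iff.2 hδ0) (Real.cosh_pos δ)
    have hev : ∀ᶠ k in atTop, ∫ z, M k z ∂P < v + Real.tanh δ * ε / 4 :=
      hlim.eventually_lt_const (by linarith [mul_pos hth hε])
    obtain ⟨K, hK⟩ := eventually_atTop.1 hev
    refine ⟨K, fun k hk => ?_⟩
    rw [hdist]
    have hS := integrable_softMin (P := P) hH hhalf (hM k) (hM K)
    have hA : Integrable (fun z => (M k z + M K z) / 2) P := ((hM k).add (hM K)).div_const 2
    have hgapI : Integrable (fun z => (M k z + M K z) / 2 - softMin H (1 / 2) (M k z) (M K z)) P :=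
      hA.sub hS
    have hgap : ∫ z, ((M k z + M K z) / 2 - softMin H (1 / 2) (M k z) (M K z)) ∂P
        < Real.tanh δ * ε / 4 := by
      rw [integral_sub hA hS, integral_div,
        integral_add (hM k) (hM K)]
      linarith [hK k hk, hK K le_rfl, hmin k K]
    calc ∫ z, |M k z - M K z| ∂P
        ≤ ∫ z, (2 / H * δ + 2 / Real.tanh δ
            * ((M k z + M K z) / 2 - softMin H (1 / 2) (M k z) (M K z))) ∂P :=
          integral_mono ((hM k).sub (hM K)).abs ((integrable_const _).add (hgapI.const_mul _))
            fun z => abs_sub_le_softMin_gap hH hδ0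
      _ = 2 / H * δ + 2 / Real.tanh δ
            * ∫ z, ((M k z + M K z) / 2 - softMin H (1 / 2) (M k z) (M K z)) ∂P := by
          rw [integral_add (integrable_const _) (hgapI.const_mul _), integral_const, probReal_univ,
            one_smul, integral_const_mul]
      _ < 2 / H * δ + 2 / Real.tanh δ * (Real.tanh δ * ε / 4) := by gcongr
      _ = ε := by
          have e : 2 / Real.tanh δ * (Real.tanh δ * ε / 4) = ε / 2 := by
            field_simp
            norm_num
          rw [e, hδ]
          field_simp
          norm_num
  obtain ⟨m, hm⟩ := cauchySeq_tendsto_of_complete hcauchy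
  have hmI : Integrable m P := L1.integrable_coeFn m
  have hL1 : Tendsto (fun k => ∫⁻ z, ‖M k z - m z‖ₑ ∂P) atTop (𝓝 0) := by
    have h1 := tendsto_iff_edist_tendsto_0.1 hm
    refine h1.congr fun k => ?_
    conv_lhs => rw [← Integrable.toL1_coeFn m hmI]
    rw [Integrable.edist_toL1_toL1]
    simp only [edist_eq_enorm_sub]
  exact ⟨m, hmI, tendsto_nhds_unique
    (tendsto_integral_of_L1 m hmI.aestronglyMeasurable (Eventually.of_forall hM) hL1) hlim, hL1⟩

end Integral

/-! ### Expectations of extended random variables -/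

section Expect

variable {Z : Type*} [MeasurableSpace Z] {P : Measure Z}

lemma expect_congr_ae {U V : Z → EReal} (h : U =ᵐ[P] V) : expect P U = expect P V := by
  unfold expect
  have h₁ : ∫⁻ z, (U z).toENNReal ∂P = ∫⁻ z, (V z).toENNReal ∂P :=
    lintegral_congr_ae (h.fun_comp EReal.toENNReal)
  have h₂ : ∫⁻ z, (-U z).toENNReal ∂P = ∫⁻ z, (-V z).toENNReal ∂P :=
    lintegral_congr_ae (h.fun_comp fun x => (-x).toENNReal)
  rw [h₁, h₂]

lemma expect_coe {u : Z → ℝ} (hu : Integrable u P) :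
    expect P (fun z => (u z : EReal)) = ((∫ z, u z ∂P : ℝ) : EReal) := by
  have h1 : ∫⁻ z, ENNReal.ofReal (u z) ∂P ≠ ⊤ := hu.lintegral_lt_top.ne
  have h2 : ∫⁻ z, ENNReal.ofReal (-u z) ∂P ≠ ⊤ := hu.neg.lintegral_lt_top.ne
  have e1 : ∀ x : ENNReal, x ≠ ⊤ → (x : EReal) = ((x.toReal : ℝ) : EReal) := fun x hx =>
    (EReal.coe_toReal (by simpa using hx) (by simp)).symm.trans (by simp)
  unfold expect
  simp only [← EReal.coe_neg, EReal.real_coe_toENNReal]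
  rw [integral_eq_lintegral_pos_part_sub_lintegral_neg_part hu, EReal.coe_sub, ← e1 _ h1,
    ← e1 _ h2]

lemma expect_eq_integral {U : Z → EReal} {u : Z → ℝ} (hU : ∀ᵐ z ∂P, U z = (u z : EReal))
    (hu : Integrable u P) : expect P U = ((∫ z, u z ∂P : ℝ) : EReal) :=
  (expect_congr_ae hU).trans (expect_coe hu)

lemma expect_lt_top {U : Z → EReal} (h : ∫⁻ z, (U z).toENNReal ∂P < ⊤) : expect P U < ⊤ := by
  unfold expect
  refine (EReal.sub_le_sub le_rfl (EReal.coe_ennreal_nonneg _)).trans_lt ?_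
  rw [sub_zero, lt_top_iff_ne_top]
  simpa using h.ne

lemma bot_lt_expect {U : Z → EReal} (h : ∫⁻ z, (-U z).toENNReal ∂P < ⊤) : ⊥ < expect P U := by
  unfold expect
  rw [sub_eq_add_neg, EReal.bot_lt_add_iff]
  refine ⟨EReal.bot_lt_zero.trans_le (EReal.coe_ennreal_nonneg _), ?_⟩
  rw [bot_lt_iff_ne_bot, Ne, EReal.neg_eq_bot_iff]
  simpa using h.ne

/-- The absolute value is the sum of the positive and the negative part. -/
lemma abs_eq_toENNReal_add (x : EReal) : x.abs = x.toENNReal + (-x).toENNReal := by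
  induction x with
  | bot => simp
  | top => simp
  | coe x =>
    rw [← EReal.coe_neg, EReal.real_coe_toENNReal, EReal.real_coe_toENNReal, EReal.abs_def]
    rcases le_total 0 x with h | h
    · rw [abs_of_nonneg h, ENNReal.ofReal_of_nonpos (neg_nonpos.2 h), add_zero]
    · rw [abs_of_nonpos h, ENNReal.ofReal_of_nonpos h, zero_add]

lemma aemeasurable_ereal_abs {U : Z → EReal} (hU : AEMeasurable U P) :
    AEMeasurable (fun z => (U z).abs) P := by
  simp_rw [abs_eq_toENNReal_add]
  exact hU.ereal_toENNReal.add (continuous_neg.measurable.comp_aemeasurable hU).ereal_toENNReal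

lemma integrable_toReal_of_expect {U : Z → EReal} (hU : AEMeasurable U P)
    (hbot : ⊥ < expect P U) (htop : expect P U < ⊤) :
    Integrable (fun z => (U z).toReal) P ∧ ∀ᵐ z ∂P, U z = ((U z).toReal : EReal) := by
  have hneg : ∫⁻ z, (-U z).toENNReal ∂P ≠ ⊤ := by
    intro h
    unfold expect at hbot
    rw [h] at hbot
    simp at hbot
  have hpos : ∫⁻ z, (U z).toENNReal ∂P ≠ ⊤ := by
    intro h
    unfold expect at htop
    rw [h] at htop
    lift (∫⁻ z, (-U z).toENNReal ∂P) to NNReal using hneg with x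
    have : ((x : ENNReal) : EReal) = ((x : ℝ) : EReal) := rfl
    rw [this] at htop
    simp at htop
  have h1 := ae_lt_top' hU.ereal_toENNReal hpos
  have h2 := ae_lt_top' (continuous_neg.measurable.comp_aemeasurable hU).ereal_toENNReal hneg
  have hae : ∀ᵐ z ∂P, U z = ((U z).toReal : EReal) := by
    filter_upwards [h1, h2] with z hz1 hz2
    refine (EReal.coe_toReal ?_ ?_).symm
    · exact EReal.toENNReal_ne_top_iff.1 hz1.ne
    · have := EReal.toENNReal_ne_top_iff.1 hz2.ne
      simpa using this
  refine ⟨⟨hU.ereal_toReal.aestronglyMeasurable, ?_⟩, hae⟩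
  have hle : ∫⁻ z, ‖(U z).toReal‖ₑ ∂P
      ≤ ∫⁻ z, (U z).toENNReal ∂P + ∫⁻ z, (-U z).toENNReal ∂P := by
    rw [← lintegral_add_left' hU.ereal_toENNReal]
    refine lintegral_mono_ae ?_
    filter_upwards [hae] with z hz
    conv_rhs => rw [hz]
    rw [← abs_eq_toENNReal_add, EReal.abs_def, Real.enorm_eq_ofReal_abs]
  exact hle.trans_lt (ENNReal.add_lt_top.2 ⟨hpos.lt_top, hneg.lt_top⟩)

end Expect

/-! ### Mix losses -/

section MixLoss

variable {F Z : Type*} [MeasurableSpace F] {ℓ : F → Z → EReal} {η : ℝ}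

lemma neg_inv_mul_log_eq_coe_iff (hη : 0 < η) {I : ENNReal} {r : ℝ} :
    ((-(1 / η) : ℝ) : EReal) * ENNReal.log I = r ↔ I = ENNReal.ofReal (Real.exp (-(η * r))) := by
  constructor
  · intro h
    rcases eq_or_ne I 0 with rfl | h0
    · rw [ENNReal.log_zero, EReal.coe_mul_bot_of_neg (by simpa using hη)] at h
      exact absurd h (EReal.coe_ne_top r).symm
    rcases eq_or_ne I ⊤ with rfl | ht
    · rw [ENNReal.log_top, EReal.coe_mul_top_of_neg (by simpa using hη)] at h
      exact absurd h (EReal.coe_ne_bot r).symm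
    rw [ENNReal.log_pos_real h0 ht, ← EReal.coe_mul, EReal.coe_eq_coe_iff] at h
    have hpos := ENNReal.toReal_pos h0 ht
    have : -(η * r) = Real.log I.toReal := by rw [← h]; field_simp
    rw [this, Real.exp_log hpos, ENNReal.ofReal_toReal ht]
  · rintro rfl
    rw [ENNReal.log_ofReal_of_pos (Real.exp_pos _), Real.log_exp, ← EReal.coe_mul,
      EReal.coe_eq_coe_iff]
    field_simp

lemma mixLoss_eq_coe_iff (hη : 0 < η) {Q : Measure F} {z : Z} {r : ℝ} :
    mixLoss η ℓ Q z = r ↔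
      ∫⁻ f, EReal.exp (((-η : ℝ) : EReal) * ℓ f z) ∂Q = ENNReal.ofReal (Real.exp (-(η * r))) :=
  neg_inv_mul_log_eq_coe_iff hη

/-- The mixture `(1 - t) Q₀ + t Q₁`. -/
def mixture (t : ℝ) (Q₀ Q₁ : Measure F) : Measure F :=
  ENNReal.ofReal (1 - t) • Q₀ + ENNReal.ofReal t • Q₁

lemma mixture_mem {t : ℝ} (ht : t ∈ Icc (0 : ℝ) 1) {Q₀ Q₁ : Measure F}
    (h₀ : Q₀ ∈ modelDistributions ℓ) (h₁ : Q₁ ∈ modelDistributions ℓ) :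
    mixture t Q₀ Q₁ ∈ modelDistributions ℓ := by
  have := h₀.1
  have := h₁.1
  refine ⟨⟨?_⟩, fun z => ?_⟩
  · simp only [mixture, Measure.coe_add, Measure.coe_smul, Pi.add_apply, Pi.smul_apply,
      measure_univ, smul_eq_mul, mul_one]
    rw [← ENNReal.ofReal_add (sub_nonneg.2 ht.2) ht.1]
    simp
  · rw [mixture, lintegral_add_measure, lintegral_smul_measure, lintegral_smul_measure]
    exact ENNReal.add_lt_top.2 ⟨ENNReal.mul_lt_top ENNReal.ofReal_lt_top (h₀.2 z),
      ENNReal.mul_lt_top ENNReal.ofReal_lt_top (h₁.2 z)⟩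

lemma mixLoss_mixture (hη : 0 < η) {t x y : ℝ} (ht : t ∈ Icc (0 : ℝ) 1) {Q₀ Q₁ : Measure F} {z : Z}
    (h₀ : mixLoss η ℓ Q₀ z = x) (h₁ : mixLoss η ℓ Q₁ z = y) :
    mixLoss η ℓ (mixture t Q₀ Q₁) z = softMin η t x y := by
  rw [mixLoss_eq_coe_iff hη] at h₀ h₁ ⊢
  rw [mixture, lintegral_add_measure, lintegral_smul_measure, lintegral_smul_measure, h₀, h₁,
    exp_softMin hη ht, smul_eq_mul, smul_eq_mul, ← ENNReal.ofReal_mul (sub_nonneg.2 ht.2),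
    ← ENNReal.ofReal_mul ht.1, ← ENNReal.ofReal_add]
  · exact mul_nonneg (sub_nonneg.2 ht.2) (Real.exp_pos _).le
  · exact mul_nonneg ht.1 (Real.exp_pos _).le

variable [MeasurableSpace Z] {P : Measure Z} {fstar : F}

lemma measurable_mixLoss (hℓ : Measurable fun p : F × Z => ℓ p.1 p.2) (Q : Measure F) [SFinite Q] :
    Measurable (mixLoss η ℓ Q) := by
  unfold mixLoss
  refine Measurable.const_mul (Measurable.ennreal_log ?_) _
  exact Measurable.lintegral_prod_left' (hℓ.const_mul _).ereal_exp

lemma dirac_mem (hprob : IsLearningProblem P ℓ fstar) (f : F) :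
    Measure.dirac f ∈ modelDistributions ℓ := by
  refine ⟨inferInstance, fun z => ?_⟩
  have hm : Measurable fun g => ℓ g z := hprob.measurable_loss.comp measurable_prodMk_right
  have hm' : Measurable fun g => (-ℓ g z).toENNReal :=
    (continuous_neg.measurable.comp hm).ereal_toENNReal
  rw [lintegral_dirac' _ hm']
  refine (EReal.toENNReal_ne_top_iff.2 ?_).lt_top
  simpa using hprob.loss_ne_bot f z

lemma mixLoss_dirac (hprob : IsLearningProblem P ℓ fstar) (hη : 0 < η) {f : F} {z : Z} {a : ℝ}
    (h : ℓ f z = a) : mixLoss η ℓ (Measure.dirac f) z = a := by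
  have hm : Measurable fun g => ℓ g z := hprob.measurable_loss.comp measurable_prodMk_right
  rw [mixLoss_eq_coe_iff hη, lintegral_dirac' _ (hm.const_mul _).ereal_exp, h, ← EReal.coe_mul,
    EReal.exp_coe, neg_mul]

lemma mixRisk_le {Q : Measure F} (hQ : Q ∈ modelDistributions ℓ) :
    mixRisk P η ℓ ≤ expect P (mixLoss η ℓ Q) :=
  iInf₂_le Q hQ

lemma mixRisk_le_integral_softMin (hη : 0 < η) {t : ℝ} (ht : t ∈ Icc (0 : ℝ) 1)
    {Q₀ Q₁ : Measure F} {X Y : Z → ℝ} (hQ₀ : Q₀ ∈ modelDistributions ℓ)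
    (hQ₁ : Q₁ ∈ modelDistributions ℓ) (hX : Integrable X P) (hY : Integrable Y P)
    (h₀ : ∀ᵐ z ∂P, mixLoss η ℓ Q₀ z = X z) (h₁ : ∀ᵐ z ∂P, mixLoss η ℓ Q₁ z = Y z) :
    mixRisk P η ℓ ≤ ((∫ z, softMin η t (X z) (Y z) ∂P : ℝ) : EReal) := by
  rw [← expect_eq_integral (U := mixLoss η ℓ (mixture t Q₀ Q₁)) ?_ (integrable_softMin hη ht hX hY)]
  · exact mixRisk_le (mixture_mem ht hQ₀ hQ₁)
  · filter_upwards [h₀, h₁] with z hz₀ hz₁ using mixLoss_mixture hη ht hz₀ hz₁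

lemma IsGrip.lintegral_exp_le_one [IsProbabilityMeasure P]
    (hℓ : Measurable fun p : F × Z => ℓ p.1 p.2) (hη : 0 < η) {m : Z → ℝ} (h : IsGrip P η ℓ m)
    {Q : Measure F} (hQ : Q ∈ modelDistributions ℓ) {N : Z → ℝ} (hN : Integrable N P)
    (hQN : ∀ᵐ z ∂P, mixLoss η ℓ Q z = N z) :
    ∫⁻ z, ENNReal.ofReal (Real.exp (-(η * (N z - m z)))) ∂P ≤ 1 := by
  obtain ⟨R, hR, hlim⟩ := h.isLimit
  obtain ⟨K, hK⟩ := eventually_atTop.1 (hlim.eventually_lt_const ENNReal.zero_lt_top)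
  have hmeas : ∀ k, Measurable (mixLoss η ℓ (R k)) := fun k =>
    have := (hR k).1
    measurable_mixLoss hℓ (R k)
  have hae : ∀ k, ∀ᵐ z ∂P, mixLoss η ℓ (R (k + K)) z
      = ((mixLoss η ℓ (R (k + K)) z).toReal : EReal) := by
    intro k
    have hm : AEMeasurable (fun z => (mixLoss η ℓ (R (k + K)) z - (m z : EReal)).abs) P := by
      simp_rw [sub_eq_add_neg]
      exact aemeasurable_ereal_abs ((hmeas _).aemeasurable.add
        (continuous_neg.measurable.comp_aemeasurable h.integrable.aemeasurable.coe_real_ereal))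
    filter_upwards [ae_lt_top' hm (hK (k + K) (by omega)).ne] with z hz
    refine (EReal.coe_toReal ?_ ?_).symm
    · intro e; simp [e] at hz
    · intro e; simp [e] at hz
  have henorm : ∀ k, ∫⁻ z, ‖(mixLoss η ℓ (R (k + K)) z).toReal - m z‖ₑ ∂P
      = ∫⁻ z, (mixLoss η ℓ (R (k + K)) z - (m z : EReal)).abs ∂P := by
    intro k
    refine lintegral_congr_ae ?_
    filter_upwards [hae k] with z hz
    conv_rhs => rw [hz]
    rw [← EReal.coe_sub, EReal.abs_def, Real.enorm_eq_ofReal_abs]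
  have hint : ∀ k, Integrable (fun z => (mixLoss η ℓ (R (k + K)) z).toReal) P := by
    intro k
    have h1 : Integrable (fun z => (mixLoss η ℓ (R (k + K)) z).toReal - m z) P :=
      ⟨(hmeas _).ereal_toReal.aestronglyMeasurable.sub h.integrable.aestronglyMeasurable,
        (henorm k).trans_lt (hK (k + K) (by omega))⟩
    exact (h1.add h.integrable).congr (Eventually.of_forall fun z => sub_add_cancel _ _)
  refine lintegral_exp_le_one_of_forall_softMin
    (M := fun k z => (mixLoss η ℓ (R (k + K)) z).toReal) hη hint h.integrable ?_ hN
    fun k t ht => ?_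
  · simp_rw [henorm]
    exact hlim.comp (tendsto_add_atTop_nat K)
  · have := mixRisk_le_integral_softMin hη ht (hR (k + K)) hQ (hint k) hN (hae k) hQN
    rwa [← h.integral_eq, EReal.coe_le_coe_iff] at this

end MixLoss

/-! ### Learning problems -/

section LearningProblem

variable {F Z : Type*} [MeasurableSpace Z] {P : Measure Z} {ℓ : F → Z → EReal} {fstar : F} {η : ℝ}

lemma WitnessCondition.excessRisk_lt_top [IsProbabilityMeasure P] {τ : ℝ → ℝ} {c : ℝ} (hc : 0 < c)
    (hW : WitnessCondition P ℓ fstar τ c) (f : F) : excessRisk P ℓ fstar f < ⊤ := by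
  by_contra htop
  rw [not_lt_top_iff] at htop
  have h := hW f (by rw [htop]; exact EReal.zero_lt_top)
  rw [htop, EReal.coe_mul_top_of_pos hc, top_le_iff] at h
  refine (expect_lt_top ?_).ne h
  calc _ ≤ ∫⁻ _, ENNReal.ofReal (τ (⊤ : EReal).toReal) ∂P := by
        refine lintegral_mono fun z => ?_
        split_ifs with hz
        · exact EReal.toENNReal_le_toENNReal hz
        · simp
    _ < ⊤ := by simp

lemma excessRisk_eq {f : F} (ha : Integrable (fun z => (ℓ f z).toReal) P)
    (ha' : ∀ᵐ z ∂P, ℓ f z = ((ℓ f z).toReal : EReal))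
    (hb : Integrable (fun z => (ℓ fstar z).toReal) P)
    (hb' : ∀ᵐ z ∂P, ℓ fstar z = ((ℓ fstar z).toReal : EReal)) :
    excessRisk P ℓ fstar f = ((∫ z, ((ℓ f z).toReal - (ℓ fstar z).toReal) ∂P : ℝ) : EReal) := by
  refine expect_eq_integral ?_ (ha.sub hb)
  filter_upwards [ha', hb'] with z h1 h2
  rw [EReal.coe_sub, ← h1, ← h2, excessLoss]

variable [MeasurableSpace F]

lemma IsLearningProblem.measurable_section (hprob : IsLearningProblem P ℓ fstar) (f : F) :
    Measurable (ℓ f) :=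
  hprob.measurable_loss.comp measurable_prodMk_left

lemma IsLearningProblem.integrable_fstar (hprob : IsLearningProblem P ℓ fstar) :
    Integrable (fun z => (ℓ fstar z).toReal) P ∧
      ∀ᵐ z ∂P, ℓ fstar z = ((ℓ fstar z).toReal : EReal) := by
  obtain ⟨f, hf⟩ := hprob.nontrivial
  exact integrable_toReal_of_expect (hprob.measurable_section _).aemeasurable
    (bot_lt_expect (hprob.negPart_finite _)) ((hprob.optimal f).trans_lt hf)

lemma IsLearningProblem.integrable_loss (hprob : IsLearningProblem P ℓ fstar) {f : F}
    (hf : excessRisk P ℓ fstar f < ⊤) :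
    Integrable (fun z => (ℓ f z).toReal) P ∧ ∀ᵐ z ∂P, ℓ f z = ((ℓ f z).toReal : EReal) := by
  obtain ⟨hbI, hb⟩ := hprob.integrable_fstar
  have hmeas : AEMeasurable (excessLoss ℓ fstar f) P := by
    refine AEMeasurable.congr (f := fun z => ℓ f z + ((-(ℓ fstar z).toReal : ℝ) : EReal)) ?_ ?_
    · exact ((hprob.measurable_section f).add
        (hprob.measurable_section fstar).ereal_toReal.neg.coe_real_ereal).aemeasurable
    · filter_upwards [hb] with z hz
      rw [excessLoss, EReal.coe_neg, ← hz, sub_eq_add_neg]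
  have hneg : ∫⁻ z, (-excessLoss ℓ fstar f z).toENNReal ∂P < ⊤ := by
    calc ∫⁻ z, (-excessLoss ℓ fstar f z).toENNReal ∂P
        ≤ ∫⁻ z, ((-ℓ f z).toENNReal + ENNReal.ofReal (ℓ fstar z).toReal) ∂P := by
          refine lintegral_mono_ae ?_
          filter_upwards [hb] with z hz
          rw [excessLoss, hz, EReal.neg_sub (by simp) (by simp), EReal.toReal_coe,
            ← EReal.real_coe_toENNReal]
          exact EReal.toENNReal_add_le
      _ < ⊤ := by
          rw [lintegral_add_right _
            (hprob.measurable_section fstar).ereal_toReal.ennreal_ofReal]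
          exact ENNReal.add_lt_top.2 ⟨hprob.negPart_finite f, hbI.lintegral_lt_top⟩
  obtain ⟨hLI, hL⟩ := integrable_toReal_of_expect hmeas (bot_lt_expect hneg) hf
  have hae : ∀ᵐ z ∂P, ℓ f z
      = (((excessLoss ℓ fstar f z).toReal + (ℓ fstar z).toReal : ℝ) : EReal) := by
    filter_upwards [hL, hb] with z hz1 hz2
    rw [EReal.coe_add, ← hz1, ← hz2, excessLoss, hz2, EReal.sub_add_cancel]
  constructor
  · refine (hLI.add hbI).congr ?_
    filter_upwards [hae] with z hz
    rw [hz, EReal.toReal_coe, Pi.add_apply]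
  · filter_upwards [hae] with z hz
    rw [hz, EReal.toReal_coe]

lemma IsLearningProblem.excessRisk_nonneg (hprob : IsLearningProblem P ℓ fstar) {f : F}
    (hf : excessRisk P ℓ fstar f < ⊤) : 0 ≤ excessRisk P ℓ fstar f := by
  obtain ⟨hbI, hb⟩ := hprob.integrable_fstar
  obtain ⟨haI, ha⟩ := hprob.integrable_loss hf
  have h := hprob.optimal f
  rw [expect_eq_integral hb hbI, expect_eq_integral ha haI, EReal.coe_le_coe_iff] at h
  rw [excessRisk_eq haI ha hbI hb, integral_sub haI hbI]
  exact_mod_cast sub_nonneg.2 h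

theorem exists_isGrip [IsProbabilityMeasure P] (hprob : IsLearningProblem P ℓ fstar) (hη : 0 < η)
    (hbot : ⊥ < mixRisk P η ℓ) : ∃ m, IsGrip P η ℓ m := by
  obtain ⟨hbI, hb⟩ := hprob.integrable_fstar
  have htop : mixRisk P η ℓ < ⊤ := by
    refine (mixRisk_le (dirac_mem hprob fstar)).trans_lt ?_
    rw [expect_eq_integral (hb.mono fun z hz => mixLoss_dirac hprob hη hz) hbI]
    exact EReal.coe_lt_top _
  set v := (mixRisk P η ℓ).toReal with hvdef
  have hv : mixRisk P η ℓ = (v : EReal) := (EReal.coe_toReal htop.ne hbot.ne').symm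
  have hex : ∀ n : ℕ, ∃ Q ∈ modelDistributions ℓ,
      expect P (mixLoss η ℓ Q) < ((v + 1 / ((n : ℝ) + 1) : ℝ) : EReal) := by
    intro n
    have h : mixRisk P η ℓ < ((v + 1 / ((n : ℝ) + 1) : ℝ) : EReal) := by
      rw [hv, EReal.coe_lt_coe_iff]
      have : (0 : ℝ) < 1 / ((n : ℝ) + 1) := by positivity
      linarith
    unfold mixRisk at h
    simpa only [iInf_lt_iff, exists_prop] using h
  choose Q hQ hQlt using hex
  have hfin : ∀ n, Integrable (fun z => (mixLoss η ℓ (Q n) z).toReal) P ∧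
      ∀ᵐ z ∂P, mixLoss η ℓ (Q n) z = ((mixLoss η ℓ (Q n) z).toReal : EReal) := by
    intro n
    have := (hQ n).1
    exact integrable_toReal_of_expect (measurable_mixLoss hprob.measurable_loss (Q n)).aemeasurable
      (hbot.trans_le (mixRisk_le (hQ n))) ((hQlt n).trans (EReal.coe_lt_top _))
  have hlim : Tendsto (fun n => ∫ z, (mixLoss η ℓ (Q n) z).toReal ∂P) atTop (𝓝 v) := by
    refine tendsto_of_tendsto_of_tendsto_of_le_of_le tendsto_const_nhds
      (by simpa using tendsto_one_div_add_atTop_nhds_zero_nat.const_add v) (fun n => ?_) fun n => ?_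
    · have := mixRisk_le (P := P) (η := η) (hQ n)
      rwa [hv, expect_eq_integral (hfin n).2 (hfin n).1, EReal.coe_le_coe_iff] at this
    · rw [← one_div]
      have := hQlt n
      rw [expect_eq_integral (hfin n).2 (hfin n).1, EReal.coe_lt_coe_iff] at this
      exact this.le
  obtain ⟨m, hm, hmv, hmlim⟩ := exists_tendsto_of_integral_softMin_ge hη (fun n => (hfin n).1) hlim
    fun j k => by
      have := mixRisk_le_integral_softMin hη (show (1 / 2 : ℝ) ∈ Icc (0 : ℝ) 1 by norm_num)
        (hQ j) (hQ k) (hfin j).1 (hfin k).1 (hfin j).2 (hfin k).2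
      rwa [hv, EReal.coe_le_coe_iff] at this
  refine ⟨m, hm, by rw [hmv, hv], Q, hQ, hmlim.congr fun n => lintegral_congr_ae ?_⟩
  filter_upwards [(hfin n).2] with z hz
  conv_rhs => rw [hz]
  rw [← EReal.coe_sub, EReal.abs_def, Real.enorm_eq_ofReal_abs]

/-- The excess risk bound under a witness condition, for a single `f` and a fixed threshold `u`. -/
theorem IsGrip.excessRisk_le [IsProbabilityMeasure P] (hprob : IsLearningProblem P ℓ fstar)
    {ηbar c u : ℝ} (hηbar : 0 < ηbar) {m : Z → ℝ} (hm : IsGrip P ηbar ℓ m) (hc : 0 < c)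
    {τ : ℝ → ℝ} (hW : WitnessCondition P ℓ fstar τ c) (f : F) (hη : 0 < η) (hηlt : η < ηbar / 2)
    (hu : 0 < u) (hτ : τ (excessRisk P ℓ fstar f).toReal = u) :
    excessRisk P ℓ fstar f ≤ (witnessConst c η ηbar (2 * u) : EReal) *
      annealed P η (fun z => ℓ f z - (m z : EReal)) := by
  obtain ⟨hbI, hb⟩ := hprob.integrable_fstar
  obtain ⟨haI, ha⟩ := hprob.integrable_loss (hW.excessRisk_lt_top hc f)
  have hηH : 2 * η < ηbar := by linarith
  set a : Z → ℝ := fun z => (ℓ f z).toReal with ha_def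
  set b : Z → ℝ := fun z => (ℓ fstar z).toReal with hb_def
  have hma : Measurable a := (hprob.measurable_section f).ereal_toReal
  have hmb : Measurable b := (hprob.measurable_section fstar).ereal_toReal
  have hrisk : excessRisk P ℓ fstar f = ((∫ z, (a z - b z) ∂P : ℝ) : EReal) :=
    excessRisk_eq haI ha hbI hb
  have hrisk0 : 0 ≤ ∫ z, (a z - b z) ∂P := by
    have := hprob.excessRisk_nonneg (hW.excessRisk_lt_top hc f)
    rw [hrisk] at this
    exact_mod_cast this
  have hG : ∀ s ∈ Icc (0 : ℝ) 1,
      ∫⁻ z, ENNReal.ofReal (Real.exp (-(ηbar * (softMin ηbar s (b z) (a z) - m z)))) ∂P ≤ 1 := by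
    intro s hs
    refine hm.lintegral_exp_le_one hprob.measurable_loss hηbar
      (mixture_mem hs (dirac_mem hprob fstar) (dirac_mem hprob f))
      (integrable_softMin hηbar hs hbI haI) ?_
    filter_upwards [ha, hb] with z hza hzb
    exact mixLoss_mixture hηbar hs (mixLoss_dirac hprob hηbar hzb) (mixLoss_dirac hprob hηbar hza)
  have hXm : AEMeasurable (fun z => a z - m z) P := haI.aemeasurable.sub hm.integrable.aemeasurable
  have hG1 := hG 1 (by simp)
  simp_rw [softMin_one hηbar] at hG1
  obtain ⟨hXH, hXH1⟩ := integrable_exp_of_lintegral_le_one hXm hG1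
  have hXI := integrable_exp_of_le hXm hη (by linarith) hXH
  have hX1 := integral_exp_le_one_of_le hη (by linarith) hXI hXH hXH1
  set I := ∫ z, Real.exp (-(η * (a z - m z))) ∂P with hI
  have hIpos : 0 < I := integral_exp_pos hXI
  have hann : annealed P η (fun z => ℓ f z - (m z : EReal))
      = ((-(1 / η) * Real.log I : ℝ) : EReal) := by
    have : ∫⁻ z, EReal.exp (((-η : ℝ) : EReal) * (ℓ f z - (m z : EReal))) ∂P = ENNReal.ofReal I := by
      rw [hI, ofReal_integral_eq_lintegral_ofReal hXI
        (Eventually.of_forall fun z => (Real.exp_pos _).le)]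
      refine lintegral_congr_ae ?_
      filter_upwards [ha] with z hz
      rw [hz, ← EReal.coe_sub, ← EReal.coe_mul, EReal.exp_coe, neg_mul]
    rw [annealed, this, ENNReal.log_ofReal_of_pos hIpos, ← EReal.coe_mul]
  have hlog : (1 - I) / η ≤ -(1 / η) * Real.log I := by
    have := Real.log_le_sub_one_of_pos hIpos
    have e : -(1 / η) * Real.log I = -Real.log I / η := by ring
    rw [e]
    gcongr
    linarith
  rw [hrisk, hann, ← EReal.coe_mul, EReal.coe_le_coe_iff]
  set C := (2 * η * u + 1) / (1 - 2 * η / ηbar) with hC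
  have hr : 0 < 1 - 2 * η / ηbar := by rw [sub_pos, div_lt_one hηbar]; exact hηH
  have hC0 : 0 ≤ C := by positivity
  have hconst : witnessConst c η ηbar (2 * u) = 1 / c * C := by
    rw [witnessConst, hC]; ring
  have hbound : c * ∫ z, (a z - b z) ∂P ≤ C * ((1 - I) / η) := by
    rcases hrisk0.eq_or_lt with h0 | hpos
    · rw [← h0, mul_zero]
      exact mul_nonneg hC0 (div_nonneg (by linarith) hη.le)
    · have hw := hW f (by rw [hrisk]; exact_mod_cast hpos)
      rw [hτ] at hw
      have hTI : Integrable (fun z => if a z - b z ≤ u then a z - b z else 0) P := by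
        refine (haI.sub hbI).norm.mono' (Measurable.ite
          (measurableSet_le (hma.sub hmb) measurable_const) (hma.sub hmb)
          measurable_const).aestronglyMeasurable (Eventually.of_forall fun z => ?_)
        split_ifs
        · rfl
        · simp
      rw [hrisk, expect_eq_integral (u := fun z => if a z - b z ≤ u then a z - b z else 0) ?_ hTI,
        ← EReal.coe_mul, EReal.coe_le_coe_iff] at hw
      · exact hw.trans (integral_truncated_le hη hηH hu haI hbI hm.integrable hma hmb hG)
      · filter_upwards [ha, hb] with z hza hzb
        have e : excessLoss ℓ fstar f z = ((a z - b z : ℝ) : EReal) := by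
          rw [excessLoss, hza, hzb, EReal.coe_sub]
        simp only [e, EReal.coe_le_coe_iff]
        split_ifs <;> simp
  have h2 : c * ∫ z, (a z - b z) ∂P ≤ C * (-(1 / η) * Real.log I) :=
    hbound.trans (mul_le_mul_of_nonneg_left hlog hC0)
  rw [hconst, mul_assoc, one_div_mul_eq_div, le_div_iff₀ hc]
  linarith

end LearningProblem

end Grip

end

theorem mainTheorem6 {F Z : Type*} [MeasurableSpace F] [MeasurableSpace Z]
    (P : Measure Z) [IsProbabilityMeasure P] (ℓ : F → Z → EReal) (fstar : F)
    (hprob : Grip.IsLearningProblem P ℓ fstar) (ηbar : ℝ) (hηbar : 0 < ηbar) :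
    (⊥ < Grip.mixRisk P ηbar ℓ → ∃ m : Z → ℝ, Grip.IsGrip P ηbar ℓ m) ∧
    ∀ m : Z → ℝ, Grip.IsGrip P ηbar ℓ m →
      ∀ c : ℝ, 0 < c → c ≤ 1 →
        (∀ τ : ℝ → ℝ, (∀ x, 0 ≤ x → 1 ≤ τ x) → AntitoneOn τ (Ioi 0) →
          Grip.WitnessCondition P ℓ fstar τ c →
          ∀ f : F, ∀ η : ℝ, 0 < η → η < ηbar / 2 →
            Grip.excessRisk P ℓ fstar f ≤
              (Grip.witnessConst c η ηbar
                  (2 * τ (Grip.excessRisk P ℓ fstar f).toReal) : EReal) *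
                Grip.annealed P η (fun z => ℓ f z - (m z : EReal))) ∧
        (∀ u : ℝ, 0 < u → Grip.WitnessCondition P ℓ fstar (fun _ => u) c →
          ∀ f : F, ∀ η : ℝ, 0 < η → η < ηbar / 2 →
            Grip.excessRisk P ℓ fstar f ≤
              (Grip.witnessConst c η ηbar (2 * u) : EReal) *
                Grip.annealed P η (fun z => ℓ f z - (m z : EReal))) := by
  refine ⟨Grip.exists_isGrip hprob hηbar, fun m hm c hc _ => ⟨?_, ?_⟩⟩
  · intro τ hτ _ hW f η hη hηlt
    have h0 : 0 ≤ (Grip.excessRisk P ℓ fstar f).toReal :=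
      EReal.toReal_nonneg (hprob.excessRisk_nonneg (hW.excessRisk_lt_top hc f))
    exact hm.excessRisk_le hprob hηbar hc hW f hη hηlt (zero_lt_one.trans_le (hτ _ h0)) rfl
  · intro u hu hW f η hη hηlt
    exact hm.excessRisk_le hprob hηbar hc hW f hη hηlt hu rfl
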